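/- For elements $x,g$ of a group $G$ put $[x,_1 g]=[x,g]=x^{-1}g^{-1}xg$ and $[x,_{n} g]=[[x,_{n-1} g],g]$ for $n\ge 2$. Let - $\overline{L}(G)$ be the set of bounded left Engel elements of $G$, i.e. of those $g\in G$ for which there is an $n\ge 1$ with $[x,_n g]=1$ for all $x\in G$; - $R(G)$ be the set of right Engel elements of $G$, i.e. of those $g\in G$ such that for every $x\in G$ there is an $n\ge 1$ with $[g,_n x]=1$; - $\overline{R}(G)$ be the set of bounded right Engel elements of $G$, i.e. of those $g\in G$ for which there is an $n\ge 1$ with $[g,_n x]=1$ for all $x\in G$. Let $\mathcal T$ be the regular binary rooted tree whose vertices are the finite words over $\{0,1\}$, and let $\Gamma$ be the first Grigorchuk group, i.e. the subgroup of $\operatorname{Aut}\mathcal T$ generated by the automorphisms $a,b,c,d$ which fix the empty word and are given on nonempty words by $a(0w)=1w$, $a(1w)=0w$ and, recursively, $$b(0w)=0\,a(w),\quad b(1w)=1\,c(w),\quad c(0w)=0\,a(w),\quad c(1w)=1\,d(w),\quad d(0w)=0w,\quad d(1w)=1\,b(w).$$ Then $$\overline{L}(\Gamma)=R(\Gamma)=\overline{R}(\Gamma)=\{1\}.$$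 -/

import Mathlib

section Engel

variable {G : Type*} [Group G]

/-- The iterated commutator `[x,_n g]`, where `[x, g] = x⁻¹ x^g` and `x^g = g⁻¹ x g`:
`[x,_0 g] = x` and `[x,_{n+1} g] = [[x,_n g], g]`. -/
def iterComm (x g : G) : ℕ → G
  | 0 => x
  | n + 1 => (iterComm x g n)⁻¹ * (g⁻¹ * iterComm x g n * g)

variable (G)

/-- The set `R(G)` of right Engel elements: `n` may depend on both `g` and `x`. -/
def rightEngel : Set G := {g | ∀ x : G, ∃ n : ℕ, 0 < n ∧ iterComm g x n = 1}

/-- The set of bounded left Engel elements: `n` may depend on `g` only. -/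
def boundedLeftEngel : Set G := {g | ∃ n : ℕ, 0 < n ∧ ∀ x : G, iterComm x g n = 1}

/-- The set of bounded right Engel elements: `n` may depend on `g` only. -/
def boundedRightEngel : Set G := {g | ∃ n : ℕ, 0 < n ∧ ∀ x : G, iterComm g x n = 1}

end Engel

namespace Grigorchuk

/-- The regular binary rooted tree. Vertices are the finite words over the alphabet `{0, 1}`
(`false` is the letter `0`, `true` is the letter `1`), the root is the empty word, and each word
`u` is joined to its two children `u0` and `u1`. -/
def binaryTree : SimpleGraph (List Bool) where
  Adj u v := (∃ x, v = u ++ [x]) ∨ (∃ x, u = v ++ [x])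
  symm := ⟨fun _ _ h => h.symm⟩
  loopless := ⟨fun u h => by rcases h with ⟨x, h⟩ | ⟨x, h⟩ <;> simp at h⟩

/-- The group of all automorphisms of the binary tree, under composition. -/
abbrev TreeAut : Type := binaryTree ≃g binaryTree

/-- The action of `a` on words: it swaps the two subtrees below the root. -/
def aFun : List Bool → List Bool
  | [] => []
  | x :: w => (!x) :: w

mutual
/-- The action of `b`, defined by `ψ(b) = (a, c)`. -/
def bFun : List Bool → List Bool
  | [] => []
  | false :: w => false :: aFun w
  | true :: w => true :: cFun w
/-- The action of `c`, defined by `ψ(c) = (a, d)`. -/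
def cFun : List Bool → List Bool
  | [] => []
  | false :: w => false :: aFun w
  | true :: w => true :: dFun w
/-- The action of `d`, defined by `ψ(d) = (1, b)`. -/
def dFun : List Bool → List Bool
  | [] => []
  | false :: w => false :: w
  | true :: w => true :: bFun w
end

theorem aFun_aFun (w : List Bool) : aFun (aFun w) = w := by
  cases w <;> simp [aFun]

theorem bcdFun_bcdFun (w : List Bool) :
    bFun (bFun w) = w ∧ cFun (cFun w) = w ∧ dFun (dFun w) = w := by
  induction w with
  | nil => simp [bFun, cFun, dFun]
  | cons x w ih => cases x <;> simp [bFun, cFun, dFun, ih, aFun_aFun]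

theorem aFun_child (u : List Bool) (x : Bool) : ∃ y, aFun (u ++ [x]) = aFun u ++ [y] := by
  cases u <;> simp [aFun]

theorem bcdFun_child (u : List Bool) (x : Bool) :
    (∃ y, bFun (u ++ [x]) = bFun u ++ [y]) ∧ (∃ y, cFun (u ++ [x]) = cFun u ++ [y]) ∧
      (∃ y, dFun (u ++ [x]) = dFun u ++ [y]) := by
  induction u with
  | nil => cases x <;> simp [bFun, cFun, dFun, aFun]
  | cons z u ih =>
    obtain ⟨ya, ha⟩ := aFun_child u x
    cases z <;> simp [bFun, cFun, dFun, ih, ha]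

/-- An involution of the vertices that maps children of `u` to children of the image of `u` is an
automorphism of the tree. -/
def ofInvolution (f : List Bool → List Bool) (hf : ∀ w, f (f w) = w)
    (hc : ∀ u x, ∃ y, f (u ++ [x]) = f u ++ [y]) : TreeAut where
  toFun := f
  invFun := f
  left_inv := hf
  right_inv := hf
  map_rel_iff' := by
    have key : ∀ u v, binaryTree.Adj u v → binaryTree.Adj (f u) (f v) := by
      rintro u v (⟨x, rfl⟩ | ⟨x, rfl⟩)
      · exact Or.inl (hc u x)
      · exact Or.inr (hc v x)
    intro u v
    refine ⟨fun h => ?_, key u v⟩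
    have h' := key _ _ h
    simpa [hf] using h'

/-- The rooted automorphism `a`. -/
def a : TreeAut := ofInvolution aFun aFun_aFun aFun_child

/-- The automorphism `b`. -/
def b : TreeAut :=
  ofInvolution bFun (fun w => (bcdFun_bcdFun w).1) (fun u x => (bcdFun_child u x).1)

/-- The automorphism `c`. -/
def c : TreeAut :=
  ofInvolution cFun (fun w => (bcdFun_bcdFun w).2.1) (fun u x => (bcdFun_child u x).2.1)

/-- The automorphism `d`. -/
def d : TreeAut :=
  ofInvolution dFun (fun w => (bcdFun_bcdFun w).2.2) (fun u x => (bcdFun_child u x).2.2)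

/-- The first Grigorchuk group, the subgroup of the automorphism group of the binary tree
generated by `a`, `b`, `c` and `d`. -/
def grigorchukGroup : Subgroup TreeAut := Subgroup.closure {a, b, c, d}

end Grigorchuk

/-!
Throughout, `ActsAt f v h` says that `f` fixes the vertex `v` and has section `h` there. Let `K` be
the normal closure of `(ab)²` in the Grigorchuk group `Γ`. It is a branching subgroup
(`exists_rigidAt`): below every vertex `v` the group `K` contains a copy of itself that acts
trivially outside the subtree at `v`.

The link with Engel conditions is that `gⁱ [x,ₙ₊₁ g] g⁻ⁱ` is the quotient of the elements
`gⁱ⁻¹ [x,ₙ g] g⁻⁽ⁱ⁻¹⁾` and `gⁱ [x,ₙ g] g⁻ⁱ`. So if the conjugates `gⁱ x g⁻ⁱ` have sections `P i` at a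
vertex `u`, then the conjugates of `[x,ₙ g]` have as sections there the `n`-th differences of the
sequence `P` (`ActsAt.conj_iterComm`).

*Bounded left Engel elements.* Let `g ≠ 1` and `n` be given. If some orbit of `g` on the vertices has
more than `n` elements, take `x` in the copy of `K` below a vertex `u` of it: then `P 0 ≠ 1` and
`P 1 = ⋯ = P n = 1`, and the `n`-th difference at `n` is `P 0`. Otherwise the orbits have bounded
length. If `u` has an orbit of maximal length `M ≥ 2`, then `g ^ M` acts trivially below `u`, and for
an `x` acting below `u` as `k ∈ K` the sections are powers of `k`, whose exponents are the `n`-th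
integral differences of a delta function on `ℤ/M`. These do not all vanish, and since `K` has
infinite exponent (`exists_zpow_ne_one`), some `k` survives (`exists_iterComm_ne_one`).

*Right Engel elements.* Let `g` move `u`, and let `x, y ∈ K`. Multiplying the copy of `y` below `u` by
an element that lives below `g u` gives an element `z` such that `z` and `[g, z]` have sections `y`
and `x` at `u` (`exists_iterComm_right_ne_one`). So it suffices that `K` is not an Engel group
(`exists_iterComm_ne_one_forall`). Take for `y` an element with an orbit of length four on vertices
below which `y⁴` acts trivially. The differences to study are then those of quadruples indexed by
`ℤ/4`, and they need not become trivial: the ninth differences of the quadruple `(ab, ca, d, 1)` fix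
the vertex `000010`, and their sections there are `ab, ca, d, 1` again (`actsAt_diff_engelCycle`).
-/

namespace Grigorchuk

/-! ### Subtrees and sections -/

/-- The automorphism `f` fixes the vertex `v` and acts on the subtree below `v` as `h` acts on the
whole tree, that is, `h` is the section of `f` at `v`. -/
def ActsAt (f : TreeAut) (v : List Bool) (h : TreeAut) : Prop :=
  ∀ w, f (v ++ w) = v ++ h w

namespace ActsAt

variable {f f' h h' k : TreeAut} {u v : List Bool}

theorem one (v : List Bool) : ActsAt 1 v 1 := fun _ => rfl

theorem nil (f : TreeAut) : ActsAt f [] f := fun _ => rfl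

theorem mul (hf : ActsAt f v h) (hf' : ActsAt f' v h') : ActsAt (f * f') v (h * h') := fun w => by
  rw [RelIso.mul_apply, hf', hf, RelIso.mul_apply]

theorem inv (hf : ActsAt f v h) : ActsAt f⁻¹ v h⁻¹ := fun w => by
  apply f.injective
  rw [RelIso.apply_inv_self, hf, RelIso.apply_inv_self]

theorem pow (hf : ActsAt f v h) (n : ℕ) : ActsAt (f ^ n) v (h ^ n) := by
  induction n with
  | zero => exact one v
  | succ n ih => rw [pow_succ, pow_succ]; exact ih.mul hf

theorem zpow (hf : ActsAt f v h) (n : ℤ) : ActsAt (f ^ n) v (h ^ n) := by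
  cases n with
  | ofNat n => simpa using hf.pow n
  | negSucc n => simpa only [zpow_negSucc] using (hf.pow (n + 1)).inv

theorem zpow_one (hf : ActsAt f v 1) (n : ℤ) : ActsAt (f ^ n) v 1 := by
  simpa using hf.zpow n

theorem append (hf : ActsAt f v h) (hh : ActsAt h u k) : ActsAt f (v ++ u) k := fun w => by
  rw [List.append_assoc, hf, hh, List.append_assoc]

theorem unique (hf : ActsAt f v h) (hf' : ActsAt f v h') : h = h' :=
  RelIso.ext fun w => List.append_cancel_left ((hf w).symm.trans (hf' w))

theorem eq_one (hf : ActsAt 1 v h) : h = 1 := hf.unique (one v)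

theorem apply_self (hf : ActsAt f v h) (hh : h [] = []) : f v = v := by
  simpa [hh] using hf []

theorem iterComm (hf : ActsAt f v h) (hf' : ActsAt f' v h') (n : ℕ) :
    ActsAt (iterComm f f' n) v (_root_.iterComm h h' n) := by
  induction n with
  | zero => exact hf
  | succ n ih => exact ih.inv.mul ((hf'.inv.mul ih).mul hf')

end ActsAt

/-- The elements of the group fix the root and map the children of a vertex to children of its
image. For an arbitrary automorphism of the graph this would need an argument; here it is inherited
from the generators. -/
theorem apply_child {g : TreeAut} (hg : g ∈ grigorchukGroup) :
    g [] = [] ∧ ∀ u x, ∃ y, g (u ++ [x]) = g u ++ [y] := by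
  induction hg using Subgroup.closure_induction with
  | mem g hg =>
    rcases hg with rfl | rfl | rfl | rfl
    · exact ⟨rfl, aFun_child⟩
    · exact ⟨by simp [b, ofInvolution, bFun], fun u x => (bcdFun_child u x).1⟩
    · exact ⟨by simp [c, ofInvolution, cFun], fun u x => (bcdFun_child u x).2.1⟩
    · exact ⟨by simp [d, ofInvolution, dFun], fun u x => (bcdFun_child u x).2.2⟩
  | one => exact ⟨rfl, fun u x => ⟨x, rfl⟩⟩
  | mul g h _ _ ihg ihh =>
    refine ⟨by rw [RelIso.mul_apply, ihh.1, ihg.1], fun u x => ?_⟩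
    obtain ⟨y, hy⟩ := ihh.2 u x
    obtain ⟨z, hz⟩ := ihg.2 (h u) y
    exact ⟨z, by rw [RelIso.mul_apply, hy, hz, RelIso.mul_apply]⟩
  | inv g _ ih =>
    have h0 : g⁻¹ [] = [] := g.injective (by rw [RelIso.apply_inv_self, ih.1])
    refine ⟨h0, fun u x => ?_⟩
    rcases List.eq_nil_or_concat' (g⁻¹ (u ++ [x])) with h | ⟨v, y, h⟩
    · have := congrArg g h
      rw [RelIso.apply_inv_self, ih.1] at this
      simp at this
    · have := congrArg g h
      obtain ⟨z, hz⟩ := ih.2 v y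
      rw [RelIso.apply_inv_self, hz] at this
      have hu : u = g v := (List.append_inj' this rfl).1
      exact ⟨y, by rw [h, hu, RelIso.inv_apply_self]⟩

theorem apply_nil {g : TreeAut} (hg : g ∈ grigorchukGroup) : g [] = [] := (apply_child hg).1

theorem exists_apply_append {g : TreeAut} (hg : g ∈ grigorchukGroup) (u w : List Bool) :
    ∃ w', g (u ++ w) = g u ++ w' := by
  induction w using List.reverseRecOn with
  | nil => exact ⟨[], by simp⟩
  | append_singleton w x ih =>
    obtain ⟨w', hw⟩ := ih
    obtain ⟨y, hy⟩ := (apply_child hg).2 (u ++ w) x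
    exact ⟨w' ++ [y], by rw [← List.append_assoc, hy, hw, List.append_assoc]⟩

theorem length_apply {g : TreeAut} (hg : g ∈ grigorchukGroup) (u : List Bool) :
    (g u).length = u.length := by
  induction u using List.reverseRecOn with
  | nil => rw [apply_nil hg]
  | append_singleton u x ih =>
    obtain ⟨y, hy⟩ := (apply_child hg).2 u x
    simp [hy, ih]

theorem apply_eq_self_of_append {g : TreeAut} (hg : g ∈ grigorchukGroup) {u w w' : List Bool}
    (h : g (u ++ w) = u ++ w') : g u = u := by
  obtain ⟨w'', hw⟩ := exists_apply_append hg u w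
  exact (List.append_inj (hw.symm.trans h) (length_apply hg u)).1

theorem not_prefix_apply {g : TreeAut} (hg : g ∈ grigorchukGroup) {u : List Bool} (hu : g u ≠ u)
    (w : List Bool) : ¬ u <+: g (u ++ w) := by
  rintro ⟨w', hw⟩
  exact hu (apply_eq_self_of_append hg hw.symm)

theorem exists_apply_ne_self {g : TreeAut} (hg : g ≠ 1) : ∃ u, g u ≠ u := by
  by_contra! h
  exact hg (RelIso.ext h)

theorem a_mem : a ∈ grigorchukGroup := Subgroup.subset_closure (by simp)
theorem b_mem : b ∈ grigorchukGroup := Subgroup.subset_closure (by simp)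
theorem c_mem : c ∈ grigorchukGroup := Subgroup.subset_closure (by simp)
theorem d_mem : d ∈ grigorchukGroup := Subgroup.subset_closure (by simp)

/-! ### Calculation with words in the generators -/

/-- The four generators, as letters of words. -/
inductive Letter
  | a | b | c | d
  deriving DecidableEq

namespace Letter

/-- The automorphism that a letter stands for. -/
def toAut : Letter → TreeAut
  | a => Grigorchuk.a
  | b => Grigorchuk.b
  | c => Grigorchuk.c
  | d => Grigorchuk.d

/-- The image of a vertex of level one. -/
def image : Letter → Bool → Bool
  | a, x => !x
  | _, x => x

/-- The section at a vertex of level one, as a word of length at most one. -/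
def sect : Letter → Bool → List Letter
  | a, _ => []
  | b, false => [a]
  | b, true => [c]
  | c, false => [a]
  | c, true => [d]
  | d, false => []
  | d, true => [b]

/-- Puts a letter in front of a word, and carries out the cancellation `ll = 1` or the product of
two different letters among `b`, `c`, `d` that may become possible there. -/
def cons : Letter → List Letter → List Letter
  | a, a :: w => w
  | b, b :: w => w
  | c, c :: w => w
  | d, d :: w => w
  | b, c :: w => d :: w
  | c, b :: w => d :: w
  | b, d :: w => c :: w
  | d, b :: w => c :: w
  | c, d :: w => b :: w
  | d, c :: w => b :: w
  | l, w => l :: w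

end Letter

/-- Words in the generators. The leftmost letter acts last. -/
abbrev Word : Type := List Letter

namespace Word

/-- The automorphism that a word stands for. -/
def toAut (w : Word) : TreeAut := (w.map Letter.toAut).prod

/-- The image of a vertex of level one. -/
def image (w : Word) (x : Bool) : Bool := w.foldr Letter.image x

/-- A word for the section at a vertex of level one. -/
def sect : Word → Bool → Word
  | [], _ => []
  | l :: w, x => l.sect (image w x) ++ sect w x

/-- The normal form of a word in the free product of `⟨a⟩` and the four-group `⟨b, c, d⟩`. -/
def reduce (w : Word) : Word := w.foldr Letter.cons []

/-- The image of a vertex. -/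
def imageAt : Word → List Bool → List Bool
  | _, [] => []
  | w, x :: v => image w x :: imageAt (reduce (sect w x)) v

/-- A word for the section at a vertex. -/
def sectAt : Word → List Bool → Word
  | w, [] => w
  | w, x :: v => sectAt (reduce (sect w x)) v

end Word

theorem aut_mul_self : a * a = 1 ∧ b * b = 1 ∧ c * c = 1 ∧ d * d = 1 :=
  ⟨RelIso.ext aFun_aFun, RelIso.ext fun w => (bcdFun_bcdFun w).1,
    RelIso.ext fun w => (bcdFun_bcdFun w).2.1, RelIso.ext fun w => (bcdFun_bcdFun w).2.2⟩

theorem b_mul_c_and_c_mul_d_and_d_mul_b : b * c = d ∧ c * d = b ∧ d * b = c := by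
  have key : ∀ w, bFun (cFun w) = dFun w ∧ cFun (dFun w) = bFun w ∧ dFun (bFun w) = cFun w := by
    intro w
    induction w with
    | nil => simp [bFun, cFun, dFun]
    | cons x w ih => cases x <;> simp [bFun, cFun, dFun, ih, aFun_aFun]
  exact ⟨RelIso.ext fun w => (key w).1, RelIso.ext fun w => (key w).2.1,
    RelIso.ext fun w => (key w).2.2⟩

theorem c_mul_b_and_d_mul_c_and_b_mul_d : c * b = d ∧ d * c = b ∧ b * d = c := by
  obtain ⟨-, hb, hc, hd⟩ := aut_mul_self
  obtain ⟨h1, h2, h3⟩ := b_mul_c_and_c_mul_d_and_d_mul_b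
  refine ⟨?_, ?_, ?_⟩
  · rw [← h2, ← mul_assoc, hc, one_mul]
  · rw [← h3, ← mul_assoc, hd, one_mul]
  · rw [← h1, ← mul_assoc, hb, one_mul]

namespace Letter

theorem toAut_mem (l : Letter) : l.toAut ∈ grigorchukGroup := by
  cases l
  exacts [a_mem, b_mem, c_mem, d_mem]

theorem toAut_mul_self (l : Letter) : l.toAut * l.toAut = 1 := by
  obtain ⟨ha, hb, hc, hd⟩ := aut_mul_self
  cases l
  exacts [ha, hb, hc, hd]

theorem toAut_inv (l : Letter) : l.toAut⁻¹ = l.toAut :=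
  inv_eq_of_mul_eq_one_left l.toAut_mul_self

end Letter

namespace Word

@[simp] theorem toAut_nil : toAut [] = 1 := rfl

@[simp] theorem toAut_cons (l : Letter) (w : Word) : toAut (l :: w) = l.toAut * toAut w := by
  simp [toAut]

@[simp] theorem toAut_append (v w : Word) : toAut (v ++ w) = toAut v * toAut w := by
  simp [toAut]

theorem toAut_mem (w : Word) : w.toAut ∈ grigorchukGroup := by
  induction w with
  | nil => exact one_mem _
  | cons l w ih => rw [toAut_cons]; exact mul_mem l.toAut_mem ih

theorem toAut_reverse (w : Word) : toAut w.reverse = (toAut w)⁻¹ := by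
  induction w with
  | nil => simp
  | cons l w ih => simp [ih, Letter.toAut_inv]

theorem toAut_letterCons (l : Letter) (w : Word) : toAut (l.cons w) = l.toAut * toAut w := by
  obtain ⟨ha, hb, hc, hd⟩ := aut_mul_self
  obtain ⟨h1, h2, h3⟩ := b_mul_c_and_c_mul_d_and_d_mul_b
  obtain ⟨h4, h5, h6⟩ := c_mul_b_and_d_mul_c_and_b_mul_d
  cases w with
  | nil => cases l <;> simp [Letter.cons]
  | cons m w =>
    cases l <;> cases m <;>
      simp [Letter.cons, Letter.toAut, ← mul_assoc, ha, hb, hc, hd, h1, h2, h3, h4, h5, h6]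

theorem toAut_reduce (w : Word) : toAut (reduce w) = toAut w := by
  induction w with
  | nil => rfl
  | cons l w ih =>
    change toAut (l.cons (reduce w)) = _
    rw [toAut_letterCons, ih, toAut_cons]

theorem toAut_apply_cons (w : Word) (x : Bool) (u : List Bool) :
    toAut w (x :: u) = image w x :: toAut (sect w x) u := by
  have hl : ∀ (l : Letter) (x : Bool) (u : List Bool),
      l.toAut (x :: u) = l.image x :: toAut (l.sect x) u := by
    intro l x u
    cases l <;> cases x <;>
      simp [Letter.toAut, Letter.image, Letter.sect, a, b, c, d, ofInvolution, aFun, bFun, cFun,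
        dFun]
  induction w with
  | nil => rfl
  | cons l w ih =>
    rw [toAut_cons, RelIso.mul_apply, ih, hl]
    simp [image, sect]

theorem toAut_apply_append (w : Word) (v u : List Bool) :
    toAut w (v ++ u) = imageAt w v ++ toAut (sectAt w v) u := by
  induction v generalizing w with
  | nil => rfl
  | cons x v ih =>
    rw [List.cons_append, toAut_apply_cons, ← toAut_reduce (sect w x), ih]
    rfl

theorem toAut_apply (w : Word) (v : List Bool) : toAut w v = imageAt w v := by
  have := toAut_apply_append w v []
  rwa [apply_nil (toAut_mem _), List.append_nil, List.append_nil] at this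

theorem actsAt_toAut {w w' : Word} {v : List Bool} (h : imageAt w v = v ∧ sectAt w v = w') :
    ActsAt w.toAut v w'.toAut := fun u => by
  rw [toAut_apply_append, h.1, h.2]

end Word
/-! ### The branching subgroup -/

/-- The normal closure of `(ab)²` in the Grigorchuk group, as a subgroup of the automorphism group
of the tree. -/
def branchSubgroup : Subgroup TreeAut :=
  Subgroup.closure {k | ∃ g ∈ grigorchukGroup, k = g * (a * b) ^ 2 * g⁻¹}

theorem conj_ab_sq_mem {g : TreeAut} (hg : g ∈ grigorchukGroup) :
    g * (a * b) ^ 2 * g⁻¹ ∈ branchSubgroup :=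
  Subgroup.subset_closure ⟨g, hg, rfl⟩

theorem ab_sq_mem : (a * b) ^ 2 ∈ branchSubgroup := by
  simpa using conj_ab_sq_mem (one_mem _)

theorem branchSubgroup_le : branchSubgroup ≤ grigorchukGroup := by
  rw [branchSubgroup, Subgroup.closure_le]
  rintro _ ⟨g, hg, rfl⟩
  exact mul_mem (mul_mem hg (pow_mem (mul_mem a_mem b_mem) 2)) (inv_mem hg)

theorem conj_mem_branchSubgroup {g k : TreeAut} (hg : g ∈ grigorchukGroup)
    (hk : k ∈ branchSubgroup) : g * k * g⁻¹ ∈ branchSubgroup := by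
  induction hk using Subgroup.closure_induction with
  | mem k hk =>
    obtain ⟨h, hh, rfl⟩ := hk
    convert conj_ab_sq_mem (mul_mem hg hh) using 1
    group
  | one => simp
  | mul k k' _ _ ih ih' =>
    convert mul_mem ih ih' using 1
    group
  | inv k _ ih =>
    convert inv_mem ih using 1
    group

theorem inv_generators : a⁻¹ = a ∧ b⁻¹ = b ∧ c⁻¹ = c ∧ d⁻¹ = d :=
  ⟨Letter.toAut_inv .a, Letter.toAut_inv .b, Letter.toAut_inv .c, Letter.toAut_inv .d⟩

open Word in
/-- The stabilizer of the vertex `0` acts on the subtree below it as the whole group. -/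
theorem exists_actsAt_false {g : TreeAut} (hg : g ∈ grigorchukGroup) :
    ∃ g' ∈ grigorchukGroup, ActsAt g' [false] g ∧ ∃ h, ActsAt g' [true] h := by
  have key : ∀ (l : Letter) (w w' : Word), (imageAt w [false] = [false] ∧ sectAt w [false] = [l]) →
      (imageAt w [true] = [true] ∧ sectAt w [true] = w') →
      ∃ g' ∈ grigorchukGroup, ActsAt g' [false] l.toAut ∧ ∃ h, ActsAt g' [true] h := by
    intro l w w' h h'
    exact ⟨w.toAut, toAut_mem w, by simpa using actsAt_toAut h, _, actsAt_toAut h'⟩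
  induction hg using Subgroup.closure_induction with
  | mem g hg =>
    rcases hg with rfl | rfl | rfl | rfl
    -- The sections at `0` of `b`, `ada`, `aba`, `aca` are `a`, `b`, `c`, `d`.
    · exact key .a [.b] [.c] (by decide) (by decide)
    · exact key .b [.a, .d, .a] [] (by decide) (by decide)
    · exact key .c [.a, .b, .a] [.a] (by decide) (by decide)
    · exact key .d [.a, .c, .a] [.a] (by decide) (by decide)
  | one => exact ⟨1, one_mem _, .one _, 1, .one _⟩
  | mul g h _ _ ihg ihh =>
    obtain ⟨g', hg, h1, k, h2⟩ := ihg
    obtain ⟨h', hh, h3, l, h4⟩ := ihh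
    exact ⟨g' * h', mul_mem hg hh, h1.mul h3, k * l, h2.mul h4⟩
  | inv g _ ih =>
    obtain ⟨g', hg, h1, k, h2⟩ := ih
    exact ⟨g'⁻¹, inv_mem hg, h1.inv, k⁻¹, h2.inv⟩

open Word in
/-- The normal closure of `(ab)²` contains its copy acting below the vertex `0`. This rests on
`(b · ada)²`, whose sections at `0` and `1` are `(ab)²` and `1`. -/
theorem exists_branchSubgroup_actsAt_false {k : TreeAut} (hk : k ∈ branchSubgroup) :
    ∃ k' ∈ branchSubgroup, ActsAt k' [false] k ∧ ActsAt k' [true] 1 := by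
  induction hk using Subgroup.closure_induction with
  | mem k hk =>
    obtain ⟨g, hg, rfl⟩ := hk
    obtain ⟨g', hg', h1, h, h2⟩ := exists_actsAt_false hg
    have hw : toAut [.b, .a, .d, .a, .b, .a, .d, .a] ∈ branchSubgroup := by
      -- `(b · ada)² = b · (ad) (ab)² (ad)⁻¹ · (ab)² · b⁻¹`
      have h := conj_mem_branchSubgroup b_mem
        (mul_mem (conj_ab_sq_mem (mul_mem a_mem d_mem)) ab_sq_mem)
      have e : toAut [.b, .a, .d, .a, .b, .a, .d, .a] =
          toAut [.b, .a, .d, .a, .b, .a, .b, .d, .a, .a, .b, .a, .b, .b] := by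
        rw [← toAut_reduce [.b, .a, .d, .a, .b, .a, .b, .d, .a, .a, .b, .a, .b, .b]]
        rfl
      rw [e]
      convert h using 1
      obtain ⟨ha, hb, -, hd⟩ := inv_generators
      simp [Letter.toAut, pow_two, mul_assoc, ha, hb, hd]
    have e : (a * b) ^ 2 = toAut [.a, .b, .a, .b] := by simp [Letter.toAut, pow_two, mul_assoc]
    refine ⟨_, conj_mem_branchSubgroup hg' hw, ?_, ?_⟩
    · rw [e]
      exact (h1.mul (actsAt_toAut (by decide))).mul h1.inv
    · have := (h2.mul (actsAt_toAut (w := [.b, .a, .d, .a, .b, .a, .d, .a]) (w' := [])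
        (by decide))).mul h2.inv
      simpa using this
  | one => exact ⟨1, one_mem _, .one _, .one _⟩
  | mul k l _ _ ihk ihl =>
    obtain ⟨k', hk, h1, h2⟩ := ihk
    obtain ⟨l', hl, h3, h4⟩ := ihl
    exact ⟨k' * l', mul_mem hk hl, h1.mul h3, h2.mul h4⟩
  | inv k _ ih =>
    obtain ⟨k', hk, h1, h2⟩ := ih
    exact ⟨k'⁻¹, inv_mem hk, h1.inv, by simpa using h2.inv⟩

theorem exists_branchSubgroup_actsAt {k : TreeAut} (hk : k ∈ branchSubgroup) (x : Bool) :
    ∃ k' ∈ branchSubgroup, ActsAt k' [x] k ∧ ActsAt k' [!x] 1 := by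
  obtain ⟨k', hk', h1, h2⟩ := exists_branchSubgroup_actsAt_false hk
  cases x with
  | false => exact ⟨k', hk', h1, h2⟩
  | true =>
    have ha := inv_generators.1
    refine ⟨a * k' * a⁻¹, conj_mem_branchSubgroup a_mem hk', fun w => ?_, fun w => ?_⟩
    · rw [ha]
      change aFun (k' ([false] ++ w)) = _
      rw [h1]
      rfl
    · rw [ha]
      change aFun (k' ([true] ++ w)) = _
      rw [h2]
      rfl

/-- The automorphism `f` acts on the subtree below `v` as `k` acts on the whole tree, and fixes
every vertex outside that subtree. -/
def RigidAt (f : TreeAut) (v : List Bool) (k : TreeAut) : Prop :=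
  ActsAt f v k ∧ ∀ w, ¬ v <+: w → f w = w

/-- The normal closure `K` of `(ab)²` is a branching subgroup: below each vertex it contains a copy
of itself. -/
theorem exists_rigidAt {k : TreeAut} (hk : k ∈ branchSubgroup) (v : List Bool) :
    ∃ k' ∈ branchSubgroup, RigidAt k' v k := by
  induction v with
  | nil => exact ⟨k, hk, .nil k, fun w hw => (hw w.nil_prefix).elim⟩
  | cons x v ih =>
    obtain ⟨l, hl, h1, h2⟩ := ih
    obtain ⟨k', hk', h3, h4⟩ := exists_branchSubgroup_actsAt hl x
    refine ⟨k', hk', h3.append h1, fun w hw => ?_⟩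
    rcases w with _ | ⟨y, w⟩
    · exact apply_nil (branchSubgroup_le hk')
    · by_cases hy : y = x
      · subst hy
        rw [List.prefix_cons_inj] at hw
        simpa [h2 w hw] using h3 w
      · have hy : y = !x := by cases x <;> cases y <;> simp_all
        subst hy
        exact h4 w

theorem RigidAt.inv {f k : TreeAut} {v : List Bool} (h : RigidAt f v k) : RigidAt f⁻¹ v k⁻¹ :=
  ⟨h.1.inv, fun w hw => f.injective (by rw [RelIso.apply_inv_self, h.2 w hw])⟩

/-- If `g` moves `v`, then the conjugate `g f g⁻¹` of an automorphism `f` living below `v` acts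
trivially below `v`. -/
theorem RigidAt.conj_of_ne {f g k : TreeAut} {v : List Bool} (h : RigidAt f v k)
    (hg : g ∈ grigorchukGroup) (hv : g v ≠ v) : ActsAt (g * f * g⁻¹) v 1 := fun w => by
  have hv' : g⁻¹ v ≠ v := fun h => hv (by rw [← h, RelIso.apply_inv_self, h])
  rw [RelIso.mul_apply, RelIso.mul_apply, h.2 _ (not_prefix_apply (inv_mem hg) hv' w),
    RelIso.apply_inv_self]
  rfl

theorem RigidAt.conj_of_actsAt {f g k : TreeAut} {v : List Bool} (h : RigidAt f v k)
    (hg : ActsAt g v 1) : ActsAt (g * f * g⁻¹) v k := by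
  simpa using (hg.mul h.1).mul hg.inv

/-! ### Iterated commutators as iterated differences -/

/-- The difference operator on sequences in a group, written multiplicatively. The index set is
`ℤ` for arbitrary sequences and `ℤ/M` for sequences of period `M`. -/
def diff {A G : Type*} [AddGroupWithOne A] [Group G] (P : A → G) (i : A) : G :=
  (P i)⁻¹ * P (i - 1)

theorem diff_comp_intCast {A G : Type*} [AddGroupWithOne A] [Group G] (P : A → G) (n : ℕ) :
    diff^[n] (fun i : ℤ => P i) = fun i : ℤ => diff^[n] P i := by
  induction n generalizing P with
  | zero => rfl
  | succ n ih =>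
    rw [Function.iterate_succ_apply, Function.iterate_succ_apply, ← ih]
    congr 1
    funext i
    simp [diff]

/-- If the conjugates `gⁱ x g⁻ⁱ` act below `v` as `P i`, then the conjugates of `[x,ₙ g]` act there
as the `n`-th differences of `P`. -/
theorem ActsAt.conj_iterComm {x g : TreeAut} {v : List Bool} {P : ℤ → TreeAut} {lo hi : ℤ}
    (h : ∀ i, lo ≤ i → i ≤ hi → ActsAt (g ^ i * x * (g ^ i)⁻¹) v (P i)) (n : ℕ) (i : ℤ)
    (hlo : lo + n ≤ i) (hhi : i ≤ hi) :
    ActsAt (g ^ i * _root_.iterComm x g n * (g ^ i)⁻¹) v (diff^[n] P i) := by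
  induction n generalizing i with
  | zero => exact h i (by simpa using hlo) hhi
  | succ n ih =>
    rw [Function.iterate_succ_apply']
    push_cast at hlo
    have e : g ^ i * _root_.iterComm x g (n + 1) * (g ^ i)⁻¹ =
        (g ^ i * _root_.iterComm x g n * (g ^ i)⁻¹)⁻¹ *
          (g ^ (i - 1) * _root_.iterComm x g n * (g ^ (i - 1))⁻¹) := by
      rw [_root_.iterComm, zpow_sub_one]
      group
    rw [e]
    exact (ih i (by omega) hhi).inv.mul (ih (i - 1) (by omega) (by omega))

theorem iterate_diff_one {A G : Type*} [AddGroupWithOne A] [Group G] (n : ℕ) :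
    diff^[n] (1 : A → G) = 1 :=
  Function.iterate_fixed (by funext i; simp [diff]) n

theorem ab_sq_pow_mem (n : ℕ) : ((a * b) ^ 2) ^ n ∈ branchSubgroup := pow_mem ab_sq_mem n

theorem ab_sq_eq : (a * b) ^ 2 = Word.toAut [.a, .b, .a, .b] := by
  simp [Letter.toAut, pow_two, mul_assoc]

/-! ### Bounded left Engel elements -/

/-- The branching subgroup has infinite exponent. If `s` moves `v`, `s²` acts trivially below
`v`, and `k'` acts below `v` as `k` and trivially elsewhere, then `(k's)²` acts below `v` as `k`. So
`(k's)²ᶠ ≠ 1` when `kᶠ ≠ 1`, while odd powers of `s` itself move `v`. -/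
theorem exists_zpow_ne_one {e : ℤ} (he : e ≠ 0) : ∃ k ∈ branchSubgroup, k ^ e ≠ 1 := by
  set v : List Bool := [false, false, false, false, false]
  obtain ⟨s, hs, hsv, hs2⟩ : ∃ s ∈ branchSubgroup, s v ≠ v ∧ ActsAt (s * s) v 1 := by
    refine ⟨_, ab_sq_pow_mem 4, ?_, ?_⟩ <;>
      rw [show ((a * b) ^ 2) ^ 4 = Word.toAut [.a, .b, .a, .b, .a, .b, .a, .b, .a, .b, .a, .b, .a,
        .b, .a, .b] by rw [ab_sq_eq]; simp [pow_succ, mul_assoc]]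
    · rw [Word.toAut_apply]
      decide
    · rw [← Word.toAut_append]
      exact Word.actsAt_toAut (w' := []) (by decide)
  have hsG := branchSubgroup_le hs
  induction hn : e.natAbs using Nat.strong_induction_on generalizing e with
  | _ n ih =>
    rcases Int.even_or_odd' e with ⟨f, rfl | rfl⟩
    · obtain ⟨k, hk, hkf⟩ := ih f.natAbs (by omega) (e := f) (by omega) rfl
      obtain ⟨k', hk', h1, h2⟩ := exists_rigidAt hk v
      refine ⟨k' * s, mul_mem hk' hs, fun h => hkf ?_⟩
      have h3 : ActsAt ((k' * s) ^ (2 : ℤ)) v k := fun w => by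
        rw [zpow_ofNat, pow_two, RelIso.mul_apply, RelIso.mul_apply, RelIso.mul_apply,
          h2 _ (not_prefix_apply hsG hsv w), ← RelIso.mul_apply s s, hs2]
        exact h1 w
      have h4 := h3.zpow f
      rw [← zpow_mul, h] at h4
      exact h4.eq_one
    · refine ⟨s, hs, fun h => hsv ?_⟩
      have h3 := (hs2.zpow_one f).inv
      rw [← pow_two, ← zpow_natCast, ← zpow_mul] at h3
      rw [zpow_add_one, mul_eq_one_iff_inv_eq] at h
      rw [← h]
      exact h3.apply_self (by simp)

theorem branchSubgroup_nontrivial : ∃ k ∈ branchSubgroup, k ≠ 1 := by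
  simpa using exists_zpow_ne_one one_ne_zero

theorem coe_iterComm {G : Type*} [Group G] {H : Subgroup G} (x g : H) (n : ℕ) :
    ((iterComm x g n : H) : G) = iterComm (x : G) g n := by
  induction n with
  | zero => rfl
  | succ n ih => simp [iterComm, ih]

/-- An element with an orbit of more than `n` vertices does not satisfy `[x,ₙ g] = 1` for all `x`:
if `x` acts as `k` below a vertex `u` of the orbit and trivially elsewhere, then the conjugate of
`[x,ₙ g]` by `gⁿ` acts below `u` as `k`. -/
theorem exists_iterComm_ne_one_of_orbit {g : TreeAut} (hg : g ∈ grigorchukGroup) {n : ℕ}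
    {u : List Bool} (hu : ∀ i : ℕ, 0 < i → i ≤ n → (g ^ i) u ≠ u) :
    ∃ x ∈ branchSubgroup, iterComm x g n ≠ 1 := by
  obtain ⟨k, hk, hk1⟩ := branchSubgroup_nontrivial
  obtain ⟨x, hx, hxu⟩ := exists_rigidAt hk u
  refine ⟨x, hx, fun h => hk1 ?_⟩
  let P : ℤ → TreeAut := fun i => if i = 0 then k else 1
  have hP1 : ∀ i : ℤ, 0 < i → P i = 1 := fun i hi => if_neg hi.ne'
  have hP : ∀ i : ℤ, 0 ≤ i → i ≤ n → ActsAt (g ^ i * x * (g ^ i)⁻¹) u (P i) := by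
    intro i h0 hi
    rcases h0.eq_or_lt with rfl | h0
    · simpa [P] using hxu.1
    · lift i to ℕ using h0.le
      rw [hP1 i h0, zpow_natCast]
      exact hxu.conj_of_ne (pow_mem hg i) (hu i (by omega) (by omega))
  have hdiff : ∀ m : ℕ, diff^[m] P m = k ∧ ∀ i : ℤ, m < i → diff^[m] P i = 1 := by
    intro m
    induction m with
    | zero => exact ⟨rfl, fun i hi => hP1 i hi⟩
    | succ m ih =>
      rw [Function.iterate_succ_apply']
      refine ⟨?_, fun i hi => ?_⟩
      · simp [diff, ih.1, ih.2 (m + 1) (by omega)]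
      · simp [diff, ih.2 i (by omega), ih.2 (i - 1) (by push_cast at hi; omega)]
  have := ActsAt.conj_iterComm hP n n (by simp) le_rfl
  rw [h, mul_one, mul_inv_cancel, (hdiff n).1] at this
  exact this.eq_one

/-- The integral iterated differences of a delta function on `ℤ/M` do not vanish for `M ≥ 2`. -/
theorem iterate_sub_single_ne_zero {M : ℕ} (hM : 2 ≤ M) (n : ℕ) :
    (fun (e : ZMod M → ℤ) i => e (i - 1) - e i)^[n] (Pi.single 0 1) ≠ 0 := by
  have : NeZero M := ⟨by omega⟩
  have : Fact (1 < M) := ⟨hM⟩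
  set D : (ZMod M → ℤ) → ZMod M → ℤ := fun e i => e (i - 1) - e i with hD
  -- A function with zero difference is constant, and every difference has sum zero.
  have hconst : ∀ e, D e = 0 → ∀ i, e i = e 0 := by
    intro e he i
    have hnat : ∀ m : ℕ, e m = e 0 := by
      intro m
      induction m with
      | zero => simp
      | succ m ih =>
        have := congrFun he ((m + 1 : ℕ) : ZMod M)
        simp only [hD, Nat.cast_succ, add_sub_cancel_right, Pi.zero_apply] at this
        rw [Nat.cast_succ]
        omega
    rw [← ZMod.natCast_zmod_val i, hnat]
  have hsum : ∀ e, ∑ i, D e i = 0 := by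
    intro e
    rw [Finset.sum_sub_distrib, sub_eq_zero]
    exact (Equiv.subRight (1 : ZMod M)).sum_comp e
  induction n with
  | zero => simp
  | succ n ih =>
    rw [Function.iterate_succ_apply']
    intro h
    have hc := hconst _ h
    rcases n with _ | n
    · have := hc 1
      simp at this
    · rw [Function.iterate_succ_apply'] at hc ih
      set f := D^[n] (Pi.single 0 1)
      refine ih (funext fun i => ?_)
      have hs := hsum f
      rw [Finset.sum_congr rfl fun i _ => hc i] at hs
      simp only [Finset.sum_const, Finset.card_univ, ZMod.card, nsmul_eq_mul, mul_eq_zero,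
        NeZero.ne, false_or] at hs
      rw [hc i, hs]
      rfl

theorem iterate_diff_zpow {A G : Type*} [AddGroupWithOne A] [Group G] (k : G) (e : A → ℤ) (n : ℕ) :
    diff^[n] (fun i => k ^ e i) = fun i => k ^ (fun (e : A → ℤ) i => e (i - 1) - e i)^[n] e i := by
  induction n generalizing e with
  | zero => rfl
  | succ n ih =>
    rw [Function.iterate_succ_apply, Function.iterate_succ_apply, ← ih]
    congr 1
    funext i
    rw [diff, ← zpow_neg, ← zpow_add, neg_add_eq_sub]

/-- Conjugates by powers of `g` of an element living below `u`, when `g ^ M` acts trivially below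
`u` and the orbit of `u` has length `M`. -/
theorem RigidAt.conj_zpow {f g k : TreeAut} {u : List Bool} {M : ℕ} (h : RigidAt f u k)
    (hg : g ∈ grigorchukGroup) (hM : ActsAt (g ^ M) u 1)
    (hu : ∀ i : ℤ, (g ^ i) u = u → (M : ℤ) ∣ i) (i : ℤ) :
    ActsAt (g ^ i * f * (g ^ i)⁻¹) u (if (i : ZMod M) = 0 then k else 1) := by
  split_ifs with hi
  · obtain ⟨j, rfl⟩ := (ZMod.intCast_zmod_eq_zero_iff_dvd i M).1 hi
    rw [zpow_mul, zpow_natCast]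
    exact h.conj_of_actsAt (hM.zpow_one j)
  · exact h.conj_of_ne (zpow_mem hg i) fun hi' =>
      hi ((ZMod.intCast_zmod_eq_zero_iff_dvd i M).2 (hu i hi'))

/-- An element `g` with a full orbit of length `M ≥ 2` is not bounded left Engel: for `x` living
below `u` as `k`, the conjugates of `[x,ₙ g]` act below `u` as powers of `k`, with exponents that
depend only on `n` and `M` and are not all zero. -/
theorem exists_iterComm_ne_one_of_period {g : TreeAut} (hg : g ∈ grigorchukGroup) {M : ℕ}
    {u : List Bool} (hM2 : 2 ≤ M) (hM : ActsAt (g ^ M) u 1)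
    (hu : ∀ i : ℤ, (g ^ i) u = u → (M : ℤ) ∣ i) (n : ℕ) :
    ∃ x ∈ branchSubgroup, iterComm x g n ≠ 1 := by
  obtain ⟨r, hr⟩ := Function.ne_iff.1 (iterate_sub_single_ne_zero hM2 n)
  obtain ⟨k, hk, hk1⟩ := exists_zpow_ne_one hr
  obtain ⟨x, hx, hxu⟩ := exists_rigidAt hk u
  refine ⟨x, hx, fun h => hk1 ?_⟩
  obtain ⟨i, rfl⟩ := ZMod.intCast_surjective r
  have := ActsAt.conj_iterComm (lo := i - n) (hi := i)
    (fun j _ _ => hxu.conj_zpow hg hM hu j) n i (by simp) le_rfl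
  rw [h, mul_one, mul_inv_cancel,
    diff_comp_intCast (fun j : ZMod M => if j = 0 then k else 1)] at this
  have e : (fun j : ZMod M => if j = 0 then k else 1) =
      fun j => k ^ (Pi.single 0 1 : ZMod M → ℤ) j := by
    funext j
    by_cases hj : j = 0 <;> simp [hj]
  rw [e, iterate_diff_zpow] at this
  exact this.eq_one

/-- A nontrivial element of the group is not bounded left Engel. -/
theorem exists_iterComm_ne_one {g : TreeAut} (hg : g ∈ grigorchukGroup) (hg1 : g ≠ 1) (n : ℕ) :
    ∃ x ∈ branchSubgroup, iterComm x g n ≠ 1 := by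
  by_cases hA : ∃ u : List Bool, ∀ i : ℕ, 0 < i → i ≤ n → (g ^ i) u ≠ u
  · obtain ⟨u, hu⟩ := hA
    exact exists_iterComm_ne_one_of_orbit hg hu
  push Not at hA
  have hpow : ∀ (i : ℕ) (u : List Bool), (g ^ i) u = g^[i] u := by
    intro i u
    induction i with
    | zero => rfl
    | succ i ih => rw [pow_succ', RelIso.mul_apply, ih, Function.iterate_succ_apply']
  set p : List Bool → ℕ := fun u => Function.minimalPeriod g u
  have hdvd : ∀ (i : ℕ) u, (g ^ i) u = u ↔ p u ∣ i := fun i u => by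
    rw [hpow]; exact Function.isPeriodicPt_iff_minimalPeriod_dvd
  have hle : ∀ u, 0 < p u ∧ p u ≤ n := fun u => by
    obtain ⟨i, h0, hi, h⟩ := hA u
    have := (hdvd i u).1 h
    exact ⟨Nat.pos_of_dvd_of_pos this h0, (Nat.le_of_dvd h0 this).trans hi⟩
  -- A vertex `u` whose orbit has maximal length `p u`. The orbits below `u` have length at least
  -- `p u`, hence exactly `p u`.
  have hbdd : BddAbove (Set.range p) := ⟨n, by rintro _ ⟨u, rfl⟩; exact (hle u).2⟩
  obtain ⟨u, hu⟩ := Nat.sSup_mem (Set.range_nonempty p) hbdd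
  have hmax : ∀ w, p w ≤ p u := fun w => hu ▸ le_csSup hbdd ⟨w, rfl⟩
  obtain ⟨w, hw⟩ := exists_apply_ne_self hg1
  have hw2 : 2 ≤ p w := by
    by_contra h
    have h1 : p w = 1 := by have := (hle w).1; omega
    exact hw (by simpa using (hdvd 1 w).2 (by rw [h1]))
  refine exists_iterComm_ne_one_of_period hg (hw2.trans (hmax w)) (u := u) (fun w => ?_)
    (fun i hi => ?_) n
  · have h1 : (g ^ p (u ++ w)) (u ++ w) = u ++ w := (hdvd _ _).2 dvd_rfl
    have h2 := (hdvd _ _).1 (apply_eq_self_of_append (pow_mem hg _) h1)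
    have h3 : p (u ++ w) = p u := le_antisymm (hmax _) (Nat.le_of_dvd (hle _).1 h2)
    rw [h3] at h1
    exact h1
  · rw [Int.natCast_dvd, ← hdvd]
    rcases Int.natAbs_eq i with h | h
    · rwa [h, zpow_natCast] at hi
    · rw [h, zpow_neg, zpow_natCast] at hi
      nth_rw 1 [← hi]
      rw [RelIso.apply_inv_self]

/-! ### Two elements of the branching subgroup with no trivial iterated commutator -/

/-- Below the vertex `100`, the stabilizer of that vertex in the branching subgroup acts as the
whole Grigorchuk group. -/
theorem exists_branchSubgroup_actsAt_of_mem {g : TreeAut} (hg : g ∈ grigorchukGroup) :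
    ∃ k ∈ branchSubgroup, ActsAt k [true, false, false] g := by
  have hc := conj_ab_sq_mem c_mem
  have ht : ((a * b) ^ 2)⁻¹ = Word.toAut [.b, .a, .b, .a] := by
    rw [ab_sq_eq, ← Word.toAut_reverse]; rfl
  have hca : (c * (a * b) ^ 2 * c⁻¹) = Word.toAut [.c, .a, .b, .a, .b, .c] := by
    rw [ab_sq_eq, inv_generators.2.2.1]; simp [Letter.toAut, mul_assoc]
  -- With `t = (ab)²`, the sections at `100` of `t (ctc)⁻¹`, `t⁴` and `t⁻¹ ctc` are `a`, `b` and `c`.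
  have ha : ∃ k ∈ branchSubgroup, ActsAt k [true, false, false] (Word.toAut [.a]) := by
    refine ⟨_, mul_mem ab_sq_mem (inv_mem hc), ?_⟩
    rw [hca, ← Word.toAut_reverse, ab_sq_eq, ← Word.toAut_append]
    exact Word.actsAt_toAut (by decide)
  have hb : ∃ k ∈ branchSubgroup, ActsAt k [true, false, false] (Word.toAut [.b]) := by
    refine ⟨_, ab_sq_pow_mem 4, ?_⟩
    rw [ab_sq_eq]
    simp only [pow_succ, pow_zero, one_mul, ← Word.toAut_append]
    exact Word.actsAt_toAut (by decide)
  have hc : ∃ k ∈ branchSubgroup, ActsAt k [true, false, false] (Word.toAut [.c]) := by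
    refine ⟨_, mul_mem (inv_mem ab_sq_mem) hc, ?_⟩
    rw [hca, ht, ← Word.toAut_append]
    exact Word.actsAt_toAut (by decide)
  simp only [Word.toAut_cons, Word.toAut_nil, mul_one, Letter.toAut] at ha hb hc
  induction hg using Subgroup.closure_induction with
  | mem g hg =>
    rcases hg with rfl | rfl | rfl | rfl
    · exact ha
    · exact hb
    · exact hc
    · obtain ⟨k, hk, h⟩ := hb
      obtain ⟨l, hl, h'⟩ := hc
      exact ⟨k * l, mul_mem hk hl, b_mul_c_and_c_mul_d_and_d_mul_b.1 ▸ h.mul h'⟩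
  | one => exact ⟨1, one_mem _, .one _⟩
  | mul g h _ _ ihg ihh =>
    obtain ⟨k, hk, h⟩ := ihg
    obtain ⟨l, hl, h'⟩ := ihh
    exact ⟨k * l, mul_mem hk hl, h.mul h'⟩
  | inv g _ ih =>
    obtain ⟨k, hk, h⟩ := ih
    exact ⟨k⁻¹, inv_mem hk, h.inv⟩

theorem ActsAt.iterate_diff {P Q : ZMod 4 → TreeAut} {v : List Bool} (h : ∀ i, ActsAt (P i) v (Q i))
    (n : ℕ) (i : ZMod 4) : ActsAt (diff^[n] P i) v (diff^[n] Q i) := by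
  induction n generalizing P Q with
  | zero => exact h i
  | succ n ih => exact ih fun j => (h j).inv.mul (h (j - 1))

/-- A quadruple of words, indexed by `ℤ/4`. -/
def quadruple (w₀ w₁ w₂ w₃ : Word) : ZMod 4 → Word :=
  (![w₀, w₁, w₂, w₃] : Fin 4 → Word)

/-- The quadruple `(ab, ca, d, 1)`, indexed by `ℤ/4`. -/
def engelCycle (i : ZMod 4) : TreeAut :=
  (quadruple [.a, .b] [.c, .a] [.d] [] i).toAut

/-- The difference operator on quadruples of words. -/
def wordDiff (Q : ZMod 4 → Word) (i : ZMod 4) : Word := Word.reduce ((Q i).reverse ++ Q (i - 1))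

theorem toAut_wordDiff (Q : ZMod 4 → Word) (i : ZMod 4) :
    (wordDiff Q i).toAut = diff (fun j => (Q j).toAut) i := by
  rw [wordDiff, Word.toAut_reduce, Word.toAut_append, Word.toAut_reverse, diff]

/-- The words of the quadruple of `n`-th differences of `Q` fix the vertex `u`, and their sections
there are, after reduction, the words in `R`. -/
def IsDiffSect (Q : ZMod 4 → Word) (n : ℕ) (u : List Bool) (R : ZMod 4 → Word) : Prop :=
  ∀ i, Word.imageAt (wordDiff^[n] Q i) u = u ∧ Word.sectAt (wordDiff^[n] Q i) u = R i

instance (Q : ZMod 4 → Word) (n : ℕ) (u : List Bool) (R : ZMod 4 → Word) :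
    Decidable (IsDiffSect Q n u R) :=
  inferInstanceAs (Decidable (∀ i,
    Word.imageAt (wordDiff^[n] Q i) u = u ∧ Word.sectAt (wordDiff^[n] Q i) u = R i))

/-- Iterated differences of a quadruple of automorphisms can be followed in stages: form some
differences, pass to sections at a common fixed vertex, and go on with the sections. -/
theorem iterate_diff_add {P : ZMod 4 → TreeAut} {Q R : ZMod 4 → Word} {m : ℕ} {v : List Bool}
    (h : ∀ i, ActsAt (diff^[m] P i) v (Q i).toAut) (n : ℕ) (u : List Bool)
    (hQ : IsDiffSect Q n u R) (i : ZMod 4) :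
    ActsAt (diff^[n + m] P i) (v ++ u) (R i).toAut := by
  have hn : ∀ i, diff^[n] (fun j => (Q j).toAut) i = (wordDiff^[n] Q i).toAut := by
    clear hQ
    induction n with
    | zero => exact fun i => rfl
    | succ n ih =>
      intro i
      rw [Function.iterate_succ_apply', Function.iterate_succ_apply', toAut_wordDiff]
      exact congrArg (fun f => diff f i) (funext ih)
  rw [Function.iterate_add_apply]
  exact (ActsAt.iterate_diff h n i).append (hn i ▸ Word.actsAt_toAut (hQ i))

/-- The quadruple `(ab, ca, d, 1)` reappears as the quadruple of sections of its ninth differences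
at the vertex `000010`. -/
theorem actsAt_diff_engelCycle (i : ZMod 4) :
    ActsAt (diff^[9] engelCycle i) [false, false, false, false, true, false] (engelCycle i) := by
  have h0 : ∀ i, ActsAt (diff^[0] engelCycle i) [] (engelCycle i) := fun i => .nil _
  have h3 := iterate_diff_add h0 3 [false]
    (R := quadruple [.a, .d] [.c, .a, .c, .a] [.a, .d, .a, .c, .a, .c] [.d, .a, .d, .a]) (by decide)
  have h5 := iterate_diff_add h3 2 [false]
    (R := quadruple [.c, .a] [.d, .a] [.d, .a, .b, .a, .d, .a, .d] [.a, .b, .a, .b, .a, .d])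
    (by decide)
  have h6 := iterate_diff_add h5 1 [false]
    (R := quadruple [.d, .a, .c] [.c] [.b, .a] [.c, .a, .b, .a, .b]) (by decide)
  have h8 := iterate_diff_add h6 2 [false]
    (R := quadruple [.a, .c, .a, .b, .a, .b] [.a, .b, .a, .c, .a] [.c, .a] [.b, .a, .c]) (by decide)
  exact iterate_diff_add h8 1 [true, false]
    (R := quadruple [.a, .b] [.c, .a] [.d] []) (by decide) i

/-- As the cycle reappears below in its own ninth differences, differences of every order are
nontrivial. -/
theorem iterate_diff_engelCycle_ne_one (n : ℕ) {P : ZMod 4 → TreeAut} {v : List Bool}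
    (h : ∀ i, ActsAt (P i) v (engelCycle i)) : diff^[n] P ≠ 1 := by
  intro hn
  induction n using Nat.strong_induction_on generalizing P v with
  | _ n ih =>
    have h9 : ∀ i, ActsAt (diff^[9] P i) _ (engelCycle i) := fun i =>
      (ActsAt.iterate_diff h 9 i).append (actsAt_diff_engelCycle i)
    rcases lt_or_ge n 9 with hlt | hge
    · -- All further differences are trivial as well, the ninth ones in particular.
      have h1 : diff^[9] P = 1 := by
        rw [← Nat.sub_add_cancel hlt.le, Function.iterate_add_apply, hn, iterate_diff_one]
      have h2 := h9 2
      rw [h1] at h2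
      -- The entry `d` of the cycle moves the vertex `100`.
      have h3 : (engelCycle 2) [true, false, false] = [true, false, false] := by
        rw [h2.eq_one]; rfl
      have h4 : engelCycle 2 = Word.toAut [.d] := rfl
      rw [h4, Word.toAut_apply] at h3
      exact absurd h3 (by decide)
    · refine ih (n - 9) (by omega) h9 ?_
      rw [← Function.iterate_add_apply, Nat.sub_add_cancel hge, hn]

theorem zpow_apply_eq_self {f : TreeAut} {v : List Bool} (h : f v = v) (n : ℤ) : (f ^ n) v = v := by
  have hinv : f⁻¹ v = v := by nth_rw 1 [← h]; rw [RelIso.inv_apply_self]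
  induction n with
  | zero => rfl
  | succ n ih => rw [zpow_add_one, RelIso.mul_apply, h, ih]
  | pred n ih => rw [zpow_sub_one, RelIso.mul_apply, hinv, ih]

/-- The branching subgroup is not an Engel group. Take `y = (ab)⁴`, which has a full orbit of length
four through `v = 00000`, and take `x` living below that orbit so that the conjugates of `x` by
powers of `y` act at the vertex `v100` as `ab`, `ca`, `d` and `1`. -/
theorem exists_iterComm_ne_one_forall :
    ∃ x ∈ branchSubgroup, ∃ y ∈ branchSubgroup, ∀ n, iterComm x y n ≠ 1 := by
  set v : List Bool := [false, false, false, false, false]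
  set y : TreeAut := ((a * b) ^ 2) ^ 2
  have hyK : y ∈ branchSubgroup := ab_sq_pow_mem 2
  have hy : y ∈ grigorchukGroup := branchSubgroup_le hyK
  have hyw : y = Word.toAut [.a, .b, .a, .b, .a, .b, .a, .b] := by
    simp only [y, ab_sq_eq]
    rw [pow_two, ← Word.toAut_append]
    rfl
  have hy4 : ActsAt (y ^ 4) v 1 := by
    rw [hyw]
    simp only [pow_succ, pow_zero, one_mul, ← Word.toAut_append]
    exact Word.actsAt_toAut (w' := []) (by decide)
  have hy2 : (y ^ 2) v ≠ v := by
    rw [hyw, pow_two, ← Word.toAut_append, Word.toAut_apply]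
    decide
  -- The period of `v` divides four and does not divide two.
  have hperiod : ∀ i : ℤ, (y ^ i) v = v → ((4 : ℕ) : ℤ) ∣ i := by
    intro i hi
    by_contra hdvd
    obtain ⟨j, m, hjm⟩ : ∃ j m : ℤ, i * j + 4 * m = 2 := by
      have : i % 4 = 1 ∨ i % 4 = 2 ∨ i % 4 = 3 := by omega
      rcases this with h | h | h
      · exact ⟨2, -2 * (i / 4), by omega⟩
      · exact ⟨1, -(i / 4), by omega⟩
      · exact ⟨2, -2 * (i / 4) - 1, by omega⟩
    have hy4' : ActsAt (y ^ (4 : ℤ)) v 1 := by simpa using hy4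
    apply hy2
    rw [← zpow_natCast, Nat.cast_ofNat, ← hjm, zpow_add, zpow_mul, zpow_mul, RelIso.mul_apply,
      (hy4'.zpow_one m).apply_self rfl]
    exact zpow_apply_eq_self hi j
  have hQ : ∀ i : ZMod 4, ∃ k ∈ branchSubgroup, ActsAt k [true, false, false] (engelCycle i) :=
    fun i => exists_branchSubgroup_actsAt_of_mem (Word.toAut_mem _)
  choose Q hQK hQ using hQ
  have hR : ∀ i : ZMod 4, ∃ f ∈ branchSubgroup, RigidAt f v (Q i) :=
    fun i => exists_rigidAt (hQK i) v
  choose f hfK hf using hR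
  -- The factor with index `j` acts below `y⁻ʲ v`.
  let F : ℕ → TreeAut := fun j => (y ^ j)⁻¹ * f j * y ^ j
  have hF : ∀ (j : ℕ) (i : ℤ), ActsAt (y ^ i * F j * (y ^ i)⁻¹) v
      (if ((i - j : ℤ) : ZMod 4) = 0 then Q j else 1) := by
    intro j i
    have e : y ^ i * F j * (y ^ i)⁻¹ = y ^ (i - j) * f j * (y ^ (i - j))⁻¹ := by
      simp only [F, zpow_sub, zpow_natCast]
      group
    rw [e]
    exact (hf j).conj_zpow hy hy4 hperiod (i - j)
  have hFK : ∀ j, F j ∈ branchSubgroup := fun j => by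
    simpa [F] using conj_mem_branchSubgroup (inv_mem (pow_mem hy j)) (hfK j)
  refine ⟨F 0 * F 1 * F 2 * F 3, mul_mem (mul_mem (mul_mem (hFK 0) (hFK 1)) (hFK 2)) (hFK 3),
    y, hyK, fun n hn => ?_⟩
  have hx : ∀ i : ℤ, ActsAt (y ^ i * (F 0 * F 1 * F 2 * F 3) * (y ^ i)⁻¹) v (Q i) := by
    intro i
    have e : y ^ i * (F 0 * F 1 * F 2 * F 3) * (y ^ i)⁻¹ = (y ^ i * F 0 * (y ^ i)⁻¹) *
        (y ^ i * F 1 * (y ^ i)⁻¹) * (y ^ i * F 2 * (y ^ i)⁻¹) * (y ^ i * F 3 * (y ^ i)⁻¹) := by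
      group
    rw [e]
    convert (((hF 0 i).mul (hF 1 i)).mul (hF 2 i)).mul (hF 3 i) using 1
    push_cast
    generalize (i : ZMod 4) = r
    rcases (by decide : ∀ r : ZMod 4, r = 0 ∨ r = 1 ∨ r = 2 ∨ r = 3) r with rfl | rfl | rfl | rfl
    all_goals simp +decide
  refine iterate_diff_engelCycle_ne_one n hQ (funext fun r => ?_)
  obtain ⟨i, rfl⟩ := ZMod.intCast_surjective r
  have := ActsAt.conj_iterComm (lo := i - n) (hi := i) (fun j _ _ => hx j) n i (by simp) le_rfl
  rw [hn, mul_one, mul_inv_cancel, diff_comp_intCast Q] at this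
  exact this.eq_one

/-! ### Right Engel elements -/

/-- If `g` moves `u`, and `p` and `q` live below `u` and act there as `y x⁻¹` and `y`, then
`z = q (g p g⁻¹)` acts below `u` as `y`, and `[g, z]` acts there as `(y x⁻¹)⁻¹ y = x`. -/
theorem exists_iterComm_right_ne_one {g : TreeAut} (hg : g ∈ grigorchukGroup) (hg1 : g ≠ 1) :
    ∃ z ∈ grigorchukGroup, ∀ n, 0 < n → iterComm g z n ≠ 1 := by
  obtain ⟨x, hx, y, hy, hxy⟩ := exists_iterComm_ne_one_forall
  obtain ⟨u, hu⟩ := exists_apply_ne_self hg1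
  obtain ⟨p, hp, hpu⟩ := exists_rigidAt (mul_mem hy (inv_mem hx)) u
  obtain ⟨q, hq, hqu⟩ := exists_rigidAt hy u
  have hu' : g⁻¹ u ≠ u := fun h => hu (by nth_rw 1 [← h]; rw [RelIso.apply_inv_self])
  refine ⟨q * (g * p * g⁻¹), mul_mem (branchSubgroup_le hq) (mul_mem (mul_mem hg
    (branchSubgroup_le hp)) (inv_mem hg)), fun n hn h => ?_⟩
  have hz : ActsAt (q * (g * p * g⁻¹)) u y := by
    simpa using hqu.1.mul (hpu.conj_of_ne hg hu)
  have hgz : ActsAt (iterComm g (q * (g * p * g⁻¹)) 1) u x := by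
    have h1 : ActsAt (g⁻¹ * q⁻¹ * g) u 1 := by
      simpa using hqu.inv.conj_of_ne (inv_mem hg) hu'
    have e : iterComm g (q * (g * p * g⁻¹)) 1 = p⁻¹ * (g⁻¹ * q⁻¹ * g) * (q * (g * p * g⁻¹)) := by
      simp only [iterComm]
      group
    rw [e]
    simpa using (hpu.1.inv.mul h1).mul hz
  obtain ⟨m, rfl⟩ : ∃ m, n = m + 1 := ⟨n - 1, by omega⟩
  have hshift : ∀ m, iterComm g (q * (g * p * g⁻¹)) (m + 1) =
      iterComm (iterComm g (q * (g * p * g⁻¹)) 1) (q * (g * p * g⁻¹)) m := by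
    intro m
    induction m with
    | zero => rfl
    | succ m ih => rw [iterComm, ih]; rfl
  have h2 := hgz.iterComm hz m
  rw [← hshift, h] at h2
  exact hxy m h2.eq_one

end Grigorchuk

open Grigorchuk in
theorem rightEngel_grigorchukGroup : rightEngel grigorchukGroup = {1} := by
  ext g
  simp only [rightEngel, Set.mem_ofPred_eq, Set.mem_singleton_iff]
  constructor
  · intro h
    by_contra hg
    obtain ⟨z, hz, hne⟩ := exists_iterComm_right_ne_one g.2 (by simpa using hg)
    obtain ⟨n, hn, h1⟩ := h ⟨z, hz⟩
    exact hne n hn (by rw [← coe_iterComm g ⟨z, hz⟩ n, h1]; rfl)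
  · rintro rfl x
    exact ⟨1, one_pos, by simp [iterComm]⟩

open Grigorchuk in
theorem boundedLeftEngel_grigorchukGroup : boundedLeftEngel grigorchukGroup = {1} := by
  ext g
  simp only [boundedLeftEngel, Set.mem_ofPred_eq, Set.mem_singleton_iff]
  constructor
  · rintro ⟨n, -, h⟩
    by_contra hg
    obtain ⟨x, hx, hne⟩ := exists_iterComm_ne_one g.2 (by simpa using hg) n
    exact hne (by rw [← coe_iterComm ⟨x, branchSubgroup_le hx⟩ g n, h]; rfl)
  · rintro rfl
    exact ⟨1, one_pos, fun x => by simp [iterComm]⟩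

theorem theorem2 :
    boundedLeftEngel Grigorchuk.grigorchukGroup = {1} ∧
      rightEngel Grigorchuk.grigorchukGroup = {1} ∧
      boundedRightEngel Grigorchuk.grigorchukGroup = {1} := by
  refine ⟨boundedLeftEngel_grigorchukGroup, rightEngel_grigorchukGroup, ?_⟩
  refine Set.Subset.antisymm ?_ ?_
  · rw [← rightEngel_grigorchukGroup]
    rintro g ⟨n, hn, h⟩ x
    exact ⟨n, hn, h x⟩
  · rintro _ rfl
    exact ⟨1, one_pos, fun x => by simp [iterComm]⟩
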